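/- **Theorem (Contraction rate of regular posterior distributions under model selection).** *Setting.* For each sample size $n\ge 1$ let the observation $X^{(n)}$ have, under the parameter $\theta$, the law $\mathbb P^{(n)}_\theta$ with density $p^{(n)}_\theta$ relative to a $\sigma$-finite measure $\mu^{(n)}$, where $(x,\theta)\mapsto p^{(n)}_\theta(x)$ is jointly measurable. Let $\Lambda$ be a finite index set of models with parameter spaces $\Theta_\lambda$, $\lambda\in\Lambda$, let $(\pi_\lambda)_{\lambda\in\Lambda}$ be prior model probabilities and $\Pi_\lambda$ a prior distribution on $\Theta_\lambda$. Let $\theta^\ast$ be the true parameter (which need not belong to any $\Theta_\lambda$), and let $d_n$ be a semimetric (pseudometric) on the parameters with $\theta\mapsto d_n(\theta,\theta^\ast)$ measurable. All of these objects may depend on $n$. The posterior of $\theta$ is $$\Pi(\theta\in B\mid X^{(n)})=\frac{\sum_{\lambda}\pi_\lambda\int_B p^{(n)}_\theta(X^{(n)})\,\Pi_\lambda(d\theta)}{\sum_{\lambda}\pi_\lambda\int p^{(n)}_\theta(X^{(n)})\,\Pi_\lambda(d\theta)} .$$ With $D(p,q)=\int p\log(p/q)\,d\mu^{(n)}$ and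 $V(p,q)=\int p\,|\log(p/q)-D(p,q)|^2d\mu^{(n)}$ (where $V=\infty$ if $D=\infty$), let $B_{n,\lambda}(\theta^\ast,\varepsilon)$ be the set of $\theta\in\Theta_\lambda$ with $D(p^{(n)}_{\theta^\ast},p^{(n)}_\theta)\le n\varepsilon^2$ and $V(p^{(n)}_{\theta^\ast},p^{(n)}_\theta)\le n\varepsilon^2$, and put (with $-\log 0=\infty$ and with minima understood as infima) $$\varepsilon_n^2=\min_{\lambda\in\Lambda}\Big\{\min_{\varepsilon>0}\Big\{\varepsilon^2-\tfrac1n\log\Pi_\lambda\big(B_{n,\lambda}(\theta^\ast,\varepsilon)\big)\Big\}-\tfrac1n\log\pi_\lambda\Big\}+\frac{\log|\Lambda|}{n}\in[0,\infty].$$ *Assumptions.* There are constants $a,b>0$, $D>1$ and $K\ge 0$, not depending on $n$ or $\lambda$, such that for every $n\ge1$ and $\lambda\in\Lambda$: 1. (test condition A1) for every $\varepsilon>0$ and $\theta_1\in\Theta_\lambda$ with $d_n(\theta_1,\theta^\ast)>\varepsilon$ there is a test $\phi$ (a measurable function of $X^{(n)}$ with values in $[0,1]$) with $\mathbb P^{(n)}_{\theta^\ast}\phi\le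 e^{-bn\varepsilon^2}$ and $\mathbb P^{(n)}_\theta(1-\phi)\le e^{-bn\varepsilon^2}$ for all $\theta\in\Theta_\lambda$ with $d_n(\theta,\theta_1)\le a\varepsilon$; 2. (sieve condition A3$'$) for every $\varepsilon>0$ with $\varepsilon\ge K\varepsilon_n$ there is a set $\mathcal F\subset\Theta_\lambda$ with $\log N(\varepsilon,\mathcal F,d_n)\le n\varepsilon^2$ and $\Pi_\lambda(\mathcal F^c)\le e^{-Dn\varepsilon^2}$, where $N(\varepsilon,\mathcal F,d_n)$ is the minimal number of closed $d_n$-balls of radius $\varepsilon$, with arbitrary parameters as centres, that cover $\mathcal F$. (For $K=0$ this is required for every $\varepsilon>0$.) Assume also that $n\varepsilon_n^2\to\infty$. *Conclusion.* For all sufficiently large constants $M$ (independent of $n$), $$\mathbb E^{(n)}_{\theta^\ast}\Big[\Pi\big(d_n^2(\theta,\theta^\ast)>M\,\varepsilon_n^2\ \big|\ X^{(n)}\big)\Big]\to0\qquad\text{as }n\to\infty .$$ -/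

import Mathlib

open MeasureTheory Filter Topology
open scoped ENNReal NNReal

noncomputable section

/-- A dominated statistical experiment together with a Bayesian model selection prior.
All members may depend on the sample size, so an asymptotic statement is about a sequence of
such objects. The observation (the whole sample) takes values in `Obs`; the type `Param` carries
the true parameter `truth` and all the model parameter spaces `paramSet k`, `k : Index`, and the
truth need not belong to any of them. -/
structure ModelSelection where
  /-- sample space -/
  Obs : Type*
  /-- ambient parameter space -/
  Param : Type*
  /-- index set of the models -/
  Index : Type*
  [measObs : MeasurableSpace Obs]
  [measParam : MeasurableSpace Param]
  /-- the semimetric on the parameters (distinct parameters may be at distance `0`) -/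
  [semimetric : PseudoMetricSpace Param]
  [fintypeIndex : Fintype Index]
  /-- dominating measure -/
  base : Measure Obs
  [sigmaFinite_base : SigmaFinite base]
  /-- density of the observation under the parameter `θ`, relative to `base` -/
  density : Param → Obs → ℝ≥0
  measurable_density : Measurable (Function.uncurry density)
  lintegral_density : ∀ θ, ∫⁻ x, (density θ x : ℝ≥0∞) ∂base = 1
  /-- true parameter -/
  truth : Param
  measurable_dist_truth : Measurable fun θ => dist θ truth
  /-- parameter space of each model -/
  paramSet : Index → Set Param
  /-- prior weights of the models -/
  weight : PMF Index
  /-- prior on the parameter, given the model -/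
  prior : Index → Measure Param
  [isProbabilityMeasure_prior : ∀ k, IsProbabilityMeasure (prior k)]
  prior_paramSet : ∀ k, ∀ᵐ θ ∂(prior k), θ ∈ paramSet k

namespace ModelSelection

attribute [instance] measObs measParam semimetric fintypeIndex sigmaFinite_base
  isProbabilityMeasure_prior

/-- The law of the observation under the parameter `θ`. -/
def law (E : ModelSelection) (θ : E.Param) : Measure E.Obs :=
  E.base.withDensity fun x => (E.density θ x : ℝ≥0∞)

/-- The Kullback-Leibler divergence `D(p_θ₀, p_θ)`, with values in `[0, ∞]`. -/
def kl (E : ModelSelection) (θ₀ θ : E.Param) : ℝ≥0∞ :=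
  InformationTheory.klDiv (E.law θ₀) (E.law θ)

open Classical in
/-- The second order discrepancy `V(p_θ₀, p_θ) = ∫ p_θ₀ |log (p_θ₀ / p_θ) - D(p_θ₀, p_θ)|²`, set to
be infinite when the divergence `D(p_θ₀, p_θ)` is. -/
def klVar (E : ModelSelection) (θ₀ θ : E.Param) : ℝ≥0∞ :=
  if E.kl θ₀ θ = ∞ then ∞
  else ∫⁻ x, ENNReal.ofReal
    ((Real.log ((E.density θ₀ x : ℝ) / (E.density θ x : ℝ)) - (E.kl θ₀ θ).toReal) ^ 2)
    ∂(E.law θ₀)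

/-- The Kullback-Leibler neighbourhood `B_n(θ*, ε)` of the truth in the parameter space of model
`k`. -/
def klBall (E : ModelSelection) (n : ℕ) (k : E.Index) (ε : ℝ) : Set E.Param :=
  {θ ∈ E.paramSet k | E.kl E.truth θ ≤ ENNReal.ofReal (n * ε ^ 2) ∧
    E.klVar E.truth θ ≤ ENNReal.ofReal (n * ε ^ 2)}

/-- `-log p` for a probability `p`, with `-log 0 = ∞`. -/
def negLog (p : ℝ≥0∞) : ℝ≥0∞ := (-ENNReal.log p).toENNReal

/-- The local Bayesian complexity `-(1/n) log Π_k(B_n(θ*, ε))` of model `k` with radius `ε`. -/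
def localComplexity (E : ModelSelection) (n : ℕ) (k : E.Index) (ε : ℝ) : ℝ≥0∞ :=
  negLog (E.prior k (E.klBall n k ε)) / n

/-- The squared oracle rate
`min_k {min_{ε > 0} {ε² - (1/n) log Π_k(B_n(θ*, ε))} - (1/n) log π_k} + (log |Λ|) / n`. -/
def oracleRateSq (E : ModelSelection) (n : ℕ) : ℝ≥0∞ :=
  (⨅ k : E.Index, (⨅ (ε : ℝ) (_ : 0 < ε), (ENNReal.ofReal (ε ^ 2) + E.localComplexity n k ε))
      + negLog (E.weight k) / n)
    + ENNReal.ofReal (Real.log (Fintype.card E.Index)) / n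

/-- The (regular) marginal posterior probability `Π(θ ∈ B | X = x)`. -/
def posterior (E : ModelSelection) (x : E.Obs) (B : Set E.Param) : ℝ≥0∞ :=
  (∑ k, E.weight k * ∫⁻ θ in B, (E.density θ x : ℝ≥0∞) ∂(E.prior k)) /
    (∑ k, E.weight k * ∫⁻ θ, (E.density θ x : ℝ≥0∞) ∂(E.prior k))

/-- The test condition for model `k` at sample size `n`, with constants `a` and `b`. A test is a
measurable function with values in `[0, 1]`. -/
def TestCondition (E : ModelSelection) (n : ℕ) (k : E.Index) (a b : ℝ) : Prop :=
  ∀ ε : ℝ, 0 < ε → ∀ θ₁ ∈ E.paramSet k, ε < dist θ₁ E.truth →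
    ∃ φ : E.Obs → ℝ≥0∞, Measurable φ ∧ (∀ x, φ x ≤ 1) ∧
      ∫⁻ x, φ x ∂(E.law E.truth) ≤ ENNReal.ofReal (Real.exp (-(b * n * ε ^ 2))) ∧
      ∀ θ ∈ E.paramSet k, dist θ θ₁ ≤ a * ε →
        ∫⁻ x, (1 - φ x) ∂(E.law θ) ≤ ENNReal.ofReal (Real.exp (-(b * n * ε ^ 2)))

/-- The sieve condition for model `k` at sample size `n`, with constant `D`, at the radius `ε`:
there is a sieve `F` with `log N(ε, F, d) ≤ n ε²` and `Π_k(Fᶜ) ≤ exp (-D n ε²)`. -/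
def SieveConditionAt (E : ModelSelection) (n : ℕ) (k : E.Index) (D : ℝ) (ε : ℝ≥0) : Prop :=
  ∃ F ⊆ E.paramSet k,
    ENNReal.log ((Metric.externalCoveringNumber ε F : ℕ∞) : ℝ≥0∞)
      ≤ ((n * (ε : ℝ) ^ 2 : ℝ) : EReal) ∧
    E.prior k Fᶜ ≤ ENNReal.ofReal (Real.exp (-(D * n * (ε : ℝ) ^ 2)))

end ModelSelection

end

/-! Write `u = n εₙ²`. The posterior is a ratio whose two parts are compared on the scale `exp (-C
u)`.

Denominator: one nearly optimal model and radius carry enough prior mass that the evidence is at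
least `exp (-3u)` times the true density, outside an event of probability at most `2/u`
(`exists_marginal_likelihood_ge`, `exists_jointMass_univ_ge`). Only second moments of the
log-likelihood ratio are controlled, so this is a Chebyshev-type bound, and the final estimate is of
order `1/u`.

Numerator: in each model, local tests are summed over a cover of the sieve (`exists_test_sieve`).
The sum over all models of these tests serves as a single global test: its level loses the factor
`|Λ| ≤ exp u`, which the term `log |Λ| / n` of the rate pays for, and its type II error within a
model is no worse than that of the model's own test. Averaging over the model weights then costs
nothing (`lintegral_posterior_le`).

With sieve radius `J εₙ` and separation `R εₙ`, for `J` and then `R` large, every exponential error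
survives division by `exp (-3u)` as at most `exp (-u) ≤ 1/u`. The total is `5/u`
(`lintegral_posterior_far_le`), which tends to `0`. -/

namespace ModelSelection

/-! ### Measurability of the divergences in the parameter -/

section Basic

variable (E : ModelSelection)

lemma measurable_density_left (θ : E.Param) : Measurable (E.density θ) :=
  E.measurable_density.comp measurable_prodMk_left

lemma measurable_coe_density :
    Measurable fun z : E.Param × E.Obs => (E.density z.1 z.2 : ℝ≥0∞) :=
  E.measurable_density.coe_nnreal_ennreal

lemma measurable_coe_density_left (θ : E.Param) :
    Measurable fun x => (E.density θ x : ℝ≥0∞) :=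
  (E.measurable_density_left θ).coe_nnreal_ennreal

instance isProbabilityMeasure_law (θ : E.Param) : IsProbabilityMeasure (E.law θ) :=
  ⟨by rw [law, withDensity_apply _ MeasurableSet.univ, Measure.restrict_univ,
    E.lintegral_density]⟩

lemma lintegral_law (θ : E.Param) {f : E.Obs → ℝ≥0∞} (hf : Measurable f) :
    ∫⁻ x, f x ∂(E.law θ) = ∫⁻ x, E.density θ x * f x ∂E.base :=
  lintegral_withDensity_eq_lintegral_mul _ (E.measurable_coe_density_left θ) hf

lemma law_absolutelyContinuous_iff (θ₀ θ : E.Param) :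
    E.law θ₀ ≪ E.law θ ↔ ∀ᵐ x ∂E.base, E.density θ₀ x ≠ 0 → E.density θ x ≠ 0 := by
  constructor
  · intro h
    have h1 : ∀ᵐ x ∂E.law θ, E.density θ x ≠ 0 := by
      rw [law, ae_withDensity_iff (E.measurable_coe_density_left θ)]
      exact ae_of_all _ fun x hx => by simpa using hx
    have h2 := h.ae_le h1
    change ∀ᵐ x ∂E.law θ₀, E.density θ x ≠ 0 at h2
    rw [law, ae_withDensity_iff (E.measurable_coe_density_left θ₀)] at h2
    filter_upwards [h2] with x hx hx0 using hx (by simpa using hx0)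
  · intro h s hs
    rw [law, withDensity_apply_eq_zero (E.measurable_coe_density_left _)] at hs ⊢
    refine measure_mono_null_ae ?_ hs
    filter_upwards [h] with x hx hxs
    exact ⟨by simpa using hx (by simpa using hxs.1), hxs.2⟩

lemma rnDeriv_law {θ₀ θ : E.Param} (h : E.law θ₀ ≪ E.law θ) :
    (E.law θ₀).rnDeriv (E.law θ) =ᵐ[E.law θ]
      fun x => ((E.density θ₀ x / E.density θ x : ℝ≥0) : ℝ≥0∞) := by
  have hm : Measurable fun x => ((E.density θ₀ x / E.density θ x : ℝ≥0) : ℝ≥0∞) :=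
    ((E.measurable_density_left θ₀).div (E.measurable_density_left θ)).coe_nnreal_ennreal
  have heq : E.law θ₀ =
      (E.law θ).withDensity fun x => ((E.density θ₀ x / E.density θ x : ℝ≥0) : ℝ≥0∞) := by
    rw [law, law, ← withDensity_mul _ (E.measurable_coe_density_left θ) hm]
    refine withDensity_congr_ae ?_
    filter_upwards [(E.law_absolutelyContinuous_iff θ₀ θ).1 h] with x hx
    rw [Pi.mul_apply, ← ENNReal.coe_mul, ENNReal.coe_inj]
    by_cases h0 : E.density θ x = 0
    · have : E.density θ₀ x = 0 := by
        by_contra h1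
        exact hx h1 h0
      simp [h0, this]
    · rw [mul_div_cancel₀ _ h0]
  conv_lhs => rw [heq]
  exact Measure.rnDeriv_withDensity _ hm

/-- The reference law in the divergence varies with `θ`. Rewriting it over the fixed measure `base`,
with a jointly measurable integrand, reduces the claim to Tonelli; absolute continuity becomes
nullity of a section of the measurable set `N`. -/
lemma measurable_kl (θ₀ : E.Param) : Measurable (E.kl θ₀) := by
  classical
  set N : Set (E.Param × E.Obs) := {z | E.density θ₀ z.2 ≠ 0 ∧ E.density z.1 z.2 = 0} with hN
  have hNm : MeasurableSet N :=
    ((((E.measurable_density_left θ₀).comp measurable_snd)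
      (measurableSet_singleton 0)).compl).inter (E.measurable_density (measurableSet_singleton 0))
  have hac : ∀ θ, E.law θ₀ ≪ E.law θ ↔ E.base (Prod.mk θ ⁻¹' N) = 0 := fun θ => by
    rw [law_absolutelyContinuous_iff, ae_iff]
    simp [hN, Set.preimage]
  have heq : E.kl θ₀ = fun θ => if E.base (Prod.mk θ ⁻¹' N) = 0 then
      ∫⁻ x, E.density θ x * ENNReal.ofReal
        (InformationTheory.klFun ((E.density θ₀ x / E.density θ x : ℝ≥0) : ℝ)) ∂E.base
      else ∞ := by
    funext θ
    rw [kl, InformationTheory.klDiv_eq_lintegral_klFun]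
    refine if_ctx_congr (hac θ) (fun h => ?_) (fun _ => rfl)
    rw [← lintegral_law]
    · refine lintegral_congr_ae ?_
      filter_upwards [E.rnDeriv_law ((hac θ).2 h)] with x hx
      rw [hx, ENNReal.coe_toReal]
    · exact (InformationTheory.measurable_klFun.comp ((E.measurable_density_left θ₀).div
        (E.measurable_density_left θ)).coe_nnreal_real).ennreal_ofReal
  rw [heq]
  refine Measurable.ite (measurable_measure_prodMk_left hNm (measurableSet_singleton 0)) ?_
    measurable_const
  refine Measurable.lintegral_prod_right' (f := fun z : E.Param × E.Obs =>
    (E.density z.1 z.2 : ℝ≥0∞) * ENNReal.ofReal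
        (InformationTheory.klFun ((E.density θ₀ z.2 / E.density z.1 z.2 : ℝ≥0) : ℝ))) ?_
  exact E.measurable_coe_density.mul (InformationTheory.measurable_klFun.comp
    (((E.measurable_density_left θ₀).comp measurable_snd).div
      E.measurable_density).coe_nnreal_real).ennreal_ofReal

/-- The squared deviation of the log-likelihood ratio from its mean. -/
noncomputable def sqDev (E : ModelSelection) (θ₀ θ : E.Param) (x : E.Obs) : ℝ≥0∞ :=
  ENNReal.ofReal
    ((Real.log ((E.density θ₀ x : ℝ) / (E.density θ x : ℝ)) - (E.kl θ₀ θ).toReal) ^ 2)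

lemma measurable_sqDev (θ₀ : E.Param) :
    Measurable fun z : E.Param × E.Obs => E.sqDev θ₀ z.1 z.2 := by
  refine Measurable.ennreal_ofReal (Measurable.pow_const (Measurable.sub (Real.measurable_log.comp
    (Measurable.div ?_ ?_)) ?_) 2)
  · exact ((E.measurable_density_left θ₀).comp measurable_snd).coe_nnreal_real
  · exact E.measurable_density.coe_nnreal_real
  · exact ((E.measurable_kl θ₀).comp measurable_fst).ennreal_toReal

lemma klVar_of_kl_ne_top {θ₀ θ : E.Param} (h : E.kl θ₀ θ ≠ ∞) :
    E.klVar θ₀ θ = ∫⁻ x, E.sqDev θ₀ θ x ∂(E.law θ₀) :=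
  if_neg h

lemma measurable_klVar (θ₀ : E.Param) : Measurable (E.klVar θ₀) := by
  classical
  have h : Measurable fun θ => ∫⁻ x, E.sqDev θ₀ θ x ∂(E.law θ₀) :=
    (E.measurable_sqDev θ₀).lintegral_prod_right'
  exact Measurable.ite (E.measurable_kl θ₀ (measurableSet_singleton _)) measurable_const h

/-- `paramSet k` is not assumed measurable, but it has full prior mass, so dropping it changes the
ball only by a null set. -/
lemma nullMeasurableSet_klBall (n : ℕ) (k : E.Index) (ε : ℝ) :
    NullMeasurableSet (E.klBall n k ε) (E.prior k) := by
  have h : MeasurableSet {θ | E.kl E.truth θ ≤ ENNReal.ofReal (n * ε ^ 2) ∧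
      E.klVar E.truth θ ≤ ENNReal.ofReal (n * ε ^ 2)} :=
    (measurableSet_le (E.measurable_kl _) measurable_const).inter
      (measurableSet_le (E.measurable_klVar _) measurable_const)
  refine h.nullMeasurableSet.congr ?_
  filter_upwards [E.prior_paramSet k] with θ hθ
  exact propext ⟨fun h => ⟨hθ, h⟩, fun h => h.2⟩

end Basic

/-! ### Lower bound for the marginal likelihood -/

section Evidence

variable (E : ModelSelection)

/-- A pointwise substitute for Jensen's inequality followed by Chebyshev's: bound `q = p exp (-(y +
d))` below by the tangent of the exponential at `L + t`, then absorb the linear term `-y` by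
completing the square `(y - t)² / (2t)`. It can be integrated against the prior directly. -/
lemma exp_mul_le_add_of_log_ratio {p q d L t : ℝ} (hp : 0 < p) (hq : 0 < q) (hd : d ≤ L)
    (ht : 0 < t) :
    Real.exp (-(L + t)) * p * (1 + t / 2) ≤
      q + Real.exp (-(L + t)) * p / (2 * t) * (Real.log (p / q) - d) ^ 2 := by
  set y := Real.log (p / q) - d with hy
  have hq' : q = p * Real.exp (-(y + d)) := by
    rw [hy, sub_add_cancel, Real.exp_neg, Real.exp_log (div_pos hp hq)]
    field_simp
  have h1 : Real.exp (-(y + d)) ≥ Real.exp (-(L + t)) * (1 + t - y) := by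
    have : Real.exp (-(y + d)) = Real.exp (-(L + t)) * Real.exp (L + t - y - d) := by
      rw [← Real.exp_add]; ring_nf
    rw [this]
    have := Real.add_one_le_exp (L + t - y - d)
    gcongr
    linarith
  have h2 : 1 + t - y + y ^ 2 / (2 * t) ≥ 1 + t / 2 := by
    have : 1 + t - y + y ^ 2 / (2 * t) - (1 + t / 2) = (y - t) ^ 2 / (2 * t) := by
      field_simp; ring
    have h3 : 0 ≤ (y - t) ^ 2 / (2 * t) := by positivity
    linarith
  have hc : 0 < Real.exp (-(L + t)) * p := by positivity
  calc Real.exp (-(L + t)) * p * (1 + t / 2)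
      ≤ Real.exp (-(L + t)) * p * (1 + t - y + y ^ 2 / (2 * t)) := by gcongr
    _ = p * (Real.exp (-(L + t)) * (1 + t - y)) +
        Real.exp (-(L + t)) * p / (2 * t) * y ^ 2 := by ring
    _ ≤ p * Real.exp (-(y + d)) + Real.exp (-(L + t)) * p / (2 * t) * y ^ 2 := by gcongr
    _ = _ := by rw [← hq']

lemma ofReal_exp_mul_le_density_add_sqDev {θ : E.Param} {x : E.Obs} {L t : ℝ}
    (h₀ : E.density E.truth x ≠ 0) (h : E.density θ x ≠ 0) (hL : 0 ≤ L)
    (hd : E.kl E.truth θ ≤ ENNReal.ofReal L) (ht : 0 < t) :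
    ENNReal.ofReal (Real.exp (-(L + t)) * E.density E.truth x * (1 + t / 2)) ≤
      E.density θ x + ENNReal.ofReal (Real.exp (-(L + t)) * E.density E.truth x / (2 * t)) *
        E.sqDev E.truth θ x := by
  have hp : (0 : ℝ) < E.density E.truth x := by positivity
  have hq : (0 : ℝ) < E.density θ x := by positivity
  have hd' : (E.kl E.truth θ).toReal ≤ L := ENNReal.toReal_le_of_le_ofReal hL hd
  have key := exp_mul_le_add_of_log_ratio hp hq hd' ht
  rw [sqDev, ← ENNReal.ofReal_mul (by positivity), ← ENNReal.ofReal_coe_nnreal (p := E.density θ x),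
    ← ENNReal.ofReal_add (by positivity) (by positivity)]
  exact ENNReal.ofReal_le_ofReal key

/-- Outside an event of small probability, the mass of a Kullback-Leibler neighbourhood bounds
the marginal likelihood of a model from below. -/
lemma exists_marginal_likelihood_ge (n : ℕ) (k : E.Index) {ε t : ℝ} (ht : 0 < t)
    (hm : E.prior k (E.klBall n k ε) ≠ 0) :
    ∃ A : Set E.Obs, MeasurableSet A ∧
      E.law E.truth Aᶜ ≤ ENNReal.ofReal (n * ε ^ 2 / t ^ 2) ∧
      ∀ᵐ x ∂E.base, x ∈ A →
        ENNReal.ofReal (Real.exp (-(n * ε ^ 2 + t))) * E.density E.truth x *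
          E.prior k (E.klBall n k ε) ≤ ∫⁻ θ, E.density θ x ∂(E.prior k) := by
  obtain ⟨B, hBsub, hBm, hBae⟩ := (E.nullMeasurableSet_klBall n k ε).exists_measurable_subset_ae_eq
  rw [← measure_congr hBae] at hm ⊢
  set L : ℝ := n * ε ^ 2 with hLdef
  have hL : 0 ≤ L := by positivity
  set ν := (E.prior k).restrict B with hν
  set m := E.prior k B with hmdef
  have hmtop : m ≠ ∞ := measure_ne_top _ _
  have hνuniv : ν Set.univ = m := by rw [hν, Measure.restrict_apply_univ]
  set Z : E.Obs → ℝ≥0∞ := fun x => ∫⁻ θ, E.sqDev E.truth θ x ∂ν with hZ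
  have hZm : Measurable Z := (E.measurable_sqDev E.truth).lintegral_prod_left'
  have hkl : ∀ θ ∈ B, E.kl E.truth θ ≤ ENNReal.ofReal L := fun θ hθ => (hBsub hθ).2.1
  have hZint : ∫⁻ x, Z x ∂(E.law E.truth) ≤ ENNReal.ofReal L * m := by
    rw [hZ, ← lintegral_lintegral_swap (f := fun θ x => E.sqDev E.truth θ x)
      (E.measurable_sqDev E.truth).aemeasurable, ← hνuniv, ← lintegral_const]
    refine setLIntegral_mono' hBm fun θ hθ => ?_
    rw [← E.klVar_of_kl_ne_top (ne_top_of_le_ne_top ENNReal.ofReal_ne_top (hkl θ hθ))]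
    exact (hBsub hθ).2.2
  -- Finite divergence gives absolute continuity for each `θ` in `B`; Fubini exchanges the two
  -- "almost every" quantifiers.
  have hpos : ∀ᵐ x ∂E.base, ∀ᵐ θ ∂ν, E.density E.truth x ≠ 0 → E.density θ x ≠ 0 := by
    have hmeas : MeasurableSet {z : E.Param × E.Obs |
        E.density E.truth z.2 ≠ 0 → E.density z.1 z.2 ≠ 0} := by
      have : {z : E.Param × E.Obs | E.density E.truth z.2 ≠ 0 → E.density z.1 z.2 ≠ 0} =
          {z | E.density E.truth z.2 = 0} ∪ {z | E.density z.1 z.2 = 0}ᶜ := by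
        ext z
        simp only [Set.mem_ofPred_eq, Set.mem_union, Set.mem_compl_iff]
        tauto
      rw [this]
      exact ((((E.measurable_density_left E.truth).comp measurable_snd)
        (measurableSet_singleton 0))).union
        (E.measurable_density (measurableSet_singleton 0)).compl
    refine (Measure.ae_ae_comm (p := fun θ x => E.density E.truth x ≠ 0 → E.density θ x ≠ 0)
      hmeas).1 (ae_restrict_of_forall_mem hBm fun θ hθ => ?_)
    refine (E.law_absolutelyContinuous_iff _ _).1 (InformationTheory.klDiv_ne_top_iff.1 ?_).1
    exact ne_top_of_le_ne_top ENNReal.ofReal_ne_top (hkl θ hθ)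
  -- `Z` has mean at most `L * m`, so Markov gives `L / t²`. On this event the quadratic term is at
  -- most `c * (t / 2) * m`, exactly the surplus in `1 + t / 2`.
  refine ⟨{x | Z x ≤ ENNReal.ofReal (t ^ 2) * m}, measurableSet_le hZm measurable_const, ?_, ?_⟩
  · have ht2 : ENNReal.ofReal (t ^ 2) ≠ 0 := by
      rw [Ne, ENNReal.ofReal_eq_zero, not_le]; positivity
    calc E.law E.truth {x | Z x ≤ ENNReal.ofReal (t ^ 2) * m}ᶜ
        ≤ E.law E.truth {x | ENNReal.ofReal (t ^ 2) * m ≤ Z x} :=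
          measure_mono fun x hx => (lt_of_not_ge (α := ℝ≥0∞) hx).le
      _ ≤ (∫⁻ x, Z x ∂(E.law E.truth)) / (ENNReal.ofReal (t ^ 2) * m) :=
          meas_ge_le_lintegral_div hZm.aemeasurable (mul_ne_zero ht2 hm)
            (ENNReal.mul_ne_top ENNReal.ofReal_ne_top hmtop)
      _ ≤ (ENNReal.ofReal L * m) / (ENNReal.ofReal (t ^ 2) * m) := by gcongr
      _ = ENNReal.ofReal (L / t ^ 2) := by
          rw [ENNReal.mul_div_mul_right _ _ hm hmtop, ENNReal.ofReal_div_of_pos (by positivity)]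
  · filter_upwards [hpos] with x hx hxA
    rcases eq_or_ne (E.density E.truth x) 0 with h0 | h0
    · simp [h0]
    set c : ℝ := Real.exp (-(L + t)) * E.density E.truth x with hc
    have hcpos : 0 < c := by positivity
    have hcE : ENNReal.ofReal (Real.exp (-(L + t))) * (E.density E.truth x : ℝ≥0∞) =
        ENNReal.ofReal c := by
      rw [hc, ENNReal.ofReal_mul (Real.exp_pos _).le, ENNReal.ofReal_coe_nnreal]
    rw [hcE]
    have hsq : Measurable fun θ => E.sqDev E.truth θ x :=
      Measurable.comp (g := fun z : E.Param × E.Obs => E.sqDev E.truth z.1 z.2)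
        (f := fun θ => (θ, x)) (E.measurable_sqDev E.truth) measurable_prodMk_right
    have hden : Measurable fun θ => (E.density θ x : ℝ≥0∞) :=
      Measurable.comp (g := fun z : E.Param × E.Obs => (E.density z.1 z.2 : ℝ≥0∞))
        (f := fun θ => (θ, x)) E.measurable_coe_density measurable_prodMk_right
    have h1 : ENNReal.ofReal (c * (1 + t / 2)) * m ≤
        (∫⁻ θ, E.density θ x ∂ν) + ENNReal.ofReal (c / (2 * t)) * Z x := by
      have hZx : ENNReal.ofReal (c / (2 * t)) * Z x =
          ∫⁻ θ, ENNReal.ofReal (c / (2 * t)) * E.sqDev E.truth θ x ∂ν :=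
        (lintegral_const_mul _ hsq).symm
      rw [hZx, ← lintegral_add_left hden, ← hνuniv, ← lintegral_const]
      refine lintegral_mono_ae ?_
      filter_upwards [hx, ae_restrict_of_forall_mem hBm hkl] with θ hθ hθkl
      exact E.ofReal_exp_mul_le_density_add_sqDev h0 (hθ h0) hL hθkl ht
    have h2 : ENNReal.ofReal (c / (2 * t)) * Z x ≤ ENNReal.ofReal (c * (t / 2)) * m := by
      calc ENNReal.ofReal (c / (2 * t)) * Z x
          ≤ ENNReal.ofReal (c / (2 * t)) * (ENNReal.ofReal (t ^ 2) * m) := by gcongr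
        _ = ENNReal.ofReal (c * (t / 2)) * m := by
            rw [← mul_assoc, ← ENNReal.ofReal_mul (by positivity)]
            congr 2
            field_simp
    have h3 : ENNReal.ofReal (c * (1 + t / 2)) * m =
        ENNReal.ofReal c * m + ENNReal.ofReal (c * (t / 2)) * m := by
      rw [mul_add, mul_one, ENNReal.ofReal_add hcpos.le (by positivity), add_mul]
    have h4 : ENNReal.ofReal c * m ≤ ∫⁻ θ, E.density θ x ∂ν := by
      refine (ENNReal.add_le_add_iff_right (a := ENNReal.ofReal (c * (t / 2)) * m)
        (ENNReal.mul_ne_top ENNReal.ofReal_ne_top hmtop)).1 ?_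
      rw [← h3]
      exact h1.trans (by gcongr)
    exact h4.trans (lintegral_mono' Measure.restrict_le_self le_rfl)

end Evidence

end ModelSelection

namespace ModelSelection

/-! ### Tests over a sieve -/

section Tests

lemma exists_finset_isCover_card_le {X : Type*} [PseudoMetricSpace X] {ε : ℝ≥0} {F : Set X} {r : ℝ}
    (h : ENNReal.log ((Metric.externalCoveringNumber ε F : ℕ∞) : ℝ≥0∞) ≤ (r : EReal)) :
    ∃ C : Finset X, Metric.IsCover ε F (C : Set X) ∧
      (C.card : ℝ≥0∞) ≤ ENNReal.ofReal (Real.exp r) := by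
  have hN : ((Metric.externalCoveringNumber ε F : ℕ∞) : ℝ≥0∞) ≤ ENNReal.ofReal (Real.exp r) := by
    rwa [← ENNReal.log_le_log_iff, ENNReal.log_ofReal_of_pos (Real.exp_pos r), Real.log_exp]
  have htop : Metric.externalCoveringNumber ε F ≠ ⊤ := fun h0 => by
    rw [h0] at hN
    exact absurd hN (by simp)
  -- The covering number is an integer infimum, so a cover with fewer than `N + 1` centres has at
  -- most `N`.
  have hlt : Metric.externalCoveringNumber ε F < Metric.externalCoveringNumber ε F + 1 :=
    ENat.lt_add_one_iff htop |>.2 le_rfl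
  conv_lhs at hlt => rw [Metric.externalCoveringNumber]
  obtain ⟨C, hC⟩ := iInf_lt_iff.1 hlt
  obtain ⟨hcov, hC⟩ := iInf_lt_iff.1 hC
  rw [ENat.lt_add_one_iff htop] at hC
  have hfin : C.Finite := Set.encard_ne_top_iff.1 (ne_top_of_le_ne_top htop hC)
  refine ⟨hfin.toFinset, by simpa using hcov, le_trans ?_ hN⟩
  rw [hfin.encard_eq_coe_toFinset_card] at hC
  exact_mod_cast (ENat.toENNReal_le.2 hC)

variable (E : ModelSelection)

/-- The sieve and the test condition provide a test of the truth against the part of the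
sieve that is far from it. -/
lemma exists_test_sieve {n : ℕ} {k : E.Index} {a b D : ℝ} (hT : E.TestCondition n k a b)
    {ε : ℝ≥0} (hS : E.SieveConditionAt n k D ε) {ρ : ℝ} (hρ : 0 < ρ) (hερ : 2 * ε ≤ a * ρ) :
    ∃ φ : E.Obs → ℝ≥0∞, Measurable φ ∧
      ∫⁻ x, φ x ∂(E.law E.truth) ≤
        ENNReal.ofReal (Real.exp (n * (ε : ℝ) ^ 2 - b * n * ρ ^ 2)) ∧
      ∃ F : Set E.Param, MeasurableSet F ∧
        E.prior k Fᶜ ≤ ENNReal.ofReal (Real.exp (-(D * n * (ε : ℝ) ^ 2))) ∧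
        ∀ θ ∈ F, ρ < dist θ E.truth →
          ∫⁻ x, (1 - φ x) ∂(E.law θ) ≤ ENNReal.ofReal (Real.exp (-(b * n * ρ ^ 2))) := by
  obtain ⟨F, hF, hN, hFc⟩ := hS
  obtain ⟨C, hC, hcard⟩ := exists_finset_isCover_card_le hN
  have hex : ∀ c : E.Param, ∃ φ : E.Obs → ℝ≥0∞, Measurable φ ∧
      ∫⁻ x, φ x ∂(E.law E.truth) ≤ ENNReal.ofReal (Real.exp (-(b * n * ρ ^ 2))) ∧
      ∀ θ ∈ F, ρ < dist θ E.truth → edist θ c ≤ ε →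
        ∫⁻ x, (1 - φ x) ∂(E.law θ) ≤ ENNReal.ofReal (Real.exp (-(b * n * ρ ^ 2))) := by
    intro c
    -- The centre `c` may lie outside the model or near the truth, so the test is anchored at a far
    -- sieve point `θ₁` of its ball. Other points of the ball are within `2ε ≤ aρ` of `θ₁`. Without
    -- such a point the zero test suffices.
    by_cases hc : ∃ θ₁ ∈ F, ρ < dist θ₁ E.truth ∧ edist θ₁ c ≤ ε
    · obtain ⟨θ₁, h₁F, h₁, h₁c⟩ := hc
      obtain ⟨φ, hφ, -, hφ0, hφ1⟩ := hT ρ hρ θ₁ (hF h₁F) h₁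
      refine ⟨φ, hφ, hφ0, fun θ hθF _ hθc => hφ1 θ (hF hθF) ?_⟩
      rw [edist_nndist, ENNReal.coe_le_coe, ← NNReal.coe_le_coe, coe_nndist] at h₁c hθc
      linarith [dist_triangle_right θ θ₁ c]
    · push Not at hc
      exact ⟨0, measurable_const, by simp, fun θ hθ h hθc => absurd (hc θ hθ h) hθc.not_gt⟩
  choose φ hφm hφ0 hφ1 using hex
  -- The sum may exceed `1`; truncated subtraction keeps `1 - φ` meaningful. The sieve, possibly
  -- nonmeasurable, is shrunk by taking a measurable hull of its complement.
  refine ⟨fun x => ∑ c ∈ C, φ c x, Finset.measurable_fun_sum _ fun c _ => hφm c, ?_,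
    (toMeasurable (E.prior k) Fᶜ)ᶜ, (measurableSet_toMeasurable _ _).compl, ?_, ?_⟩
  · rw [lintegral_finsetSum _ fun c _ => hφm c]
    calc ∑ c ∈ C, ∫⁻ x, φ c x ∂(E.law E.truth)
        ≤ ∑ c ∈ C, ENNReal.ofReal (Real.exp (-(b * n * ρ ^ 2))) :=
          Finset.sum_le_sum fun c _ => hφ0 c
      _ = C.card * ENNReal.ofReal (Real.exp (-(b * n * ρ ^ 2))) := by
          rw [Finset.sum_const, nsmul_eq_mul]
      _ ≤ ENNReal.ofReal (Real.exp (n * (ε : ℝ) ^ 2)) *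
          ENNReal.ofReal (Real.exp (-(b * n * ρ ^ 2))) := by gcongr
      _ = _ := by rw [← ENNReal.ofReal_mul (Real.exp_pos _).le, ← Real.exp_add, sub_eq_add_neg]
  · rw [compl_compl, measure_toMeasurable]
    exact hFc
  · intro θ hθ hθρ
    have hθF : θ ∈ F := by
      by_contra h
      exact hθ (subset_toMeasurable _ _ h)
    obtain ⟨c, hc, hθc⟩ := hC hθF
    refine le_trans (lintegral_mono fun x => ?_) (hφ1 c θ hθF hθρ hθc)
    exact tsub_le_tsub_left (Finset.single_le_sum (f := fun c => φ c x) (fun _ _ => zero_le)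
      (Finset.mem_coe.1 hc)) _

end Tests

/-! ### Splitting the expected posterior mass -/

section Decomposition

variable (E : ModelSelection)

/-- The numerator of the posterior probability of `B`. -/
noncomputable def jointMass (E : ModelSelection) (x : E.Obs) (B : Set E.Param) : ℝ≥0∞ :=
  ∑ k, E.weight k * ∫⁻ θ in B, (E.density θ x : ℝ≥0∞) ∂(E.prior k)

lemma posterior_eq_jointMass_div (x : E.Obs) (B : Set E.Param) :
    E.posterior x B = E.jointMass x B / E.jointMass x Set.univ := by
  simp only [posterior, jointMass, Measure.restrict_univ]

lemma jointMass_mono (x : E.Obs) {B C : Set E.Param} (h : B ⊆ C) :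
    E.jointMass x B ≤ E.jointMass x C :=
  Finset.sum_le_sum fun _ _ => mul_le_mul_right (lintegral_mono_set h) _

lemma measurable_setLIntegral_density (k : E.Index) (B : Set E.Param) :
    Measurable fun x => ∫⁻ θ in B, (E.density θ x : ℝ≥0∞) ∂(E.prior k) :=
  Measurable.lintegral_prod_left'
    (f := fun z : E.Param × E.Obs => (E.density z.1 z.2 : ℝ≥0∞)) E.measurable_coe_density

lemma measurable_jointMass (B : Set E.Param) : Measurable fun x => E.jointMass x B :=
  Finset.measurable_fun_sum _ fun k _ => (E.measurable_setLIntegral_density k B).const_mul _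

lemma measurable_posterior (B : Set E.Param) : Measurable fun x => E.posterior x B := by
  simp only [posterior_eq_jointMass_div]
  exact (E.measurable_jointMass B).div (E.measurable_jointMass _)

lemma posterior_le_one (x : E.Obs) (B : Set E.Param) : E.posterior x B ≤ 1 := by
  rw [posterior_eq_jointMass_div]
  exact ENNReal.div_le_of_le_mul (by simpa using E.jointMass_mono x (Set.subset_univ B))

lemma lintegral_mul_setLIntegral_density {ψ : E.Obs → ℝ≥0∞} (hψ : Measurable ψ) (k : E.Index)
    (B : Set E.Param) :
    ∫⁻ x, ψ x * ∫⁻ θ in B, (E.density θ x : ℝ≥0∞) ∂(E.prior k) ∂E.base =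
      ∫⁻ θ in B, ∫⁻ x, ψ x ∂(E.law θ) ∂(E.prior k) := by
  have hm : ∀ x, Measurable fun θ => (E.density θ x : ℝ≥0∞) := fun x =>
    Measurable.comp (g := fun z : E.Param × E.Obs => (E.density z.1 z.2 : ℝ≥0∞))
        (f := fun θ => (θ, x)) E.measurable_coe_density measurable_prodMk_right
  have hl : ∀ x, ψ x * ∫⁻ θ in B, (E.density θ x : ℝ≥0∞) ∂(E.prior k) =
      ∫⁻ θ in B, E.density θ x * ψ x ∂(E.prior k) := fun x => by
    rw [lintegral_mul_const _ (hm x), mul_comm]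
  simp_rw [hl, E.lintegral_law _ hψ]
  rw [lintegral_lintegral_swap (f := fun θ x => (E.density θ x : ℝ≥0∞) * ψ x)]
  · exact (E.measurable_coe_density.mul (hψ.comp measurable_snd)).aemeasurable

/-- Expected posterior mass, split according to a test, a lower bound of the marginal likelihood
that holds on an event `A`, and sieves `F k`. -/
lemma lintegral_posterior_le {φ : E.Index → E.Obs → ℝ≥0∞} (hφ : ∀ k, Measurable (φ k))
    {S : Set E.Param} (hS : MeasurableSet S) {F : E.Index → Set E.Param}
    (hF : ∀ k, MeasurableSet (F k)) {A : Set E.Obs} (hA : MeasurableSet A) {c : ℝ≥0∞} (hc : c ≠ 0)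
    (hc' : c ≠ ∞)
    (hAc : ∀ᵐ x ∂E.base, x ∈ A → c * E.density E.truth x ≤ E.jointMass x Set.univ)
    {α β γ : ℝ≥0∞} (hα : ∀ k, ∫⁻ x, φ k x ∂(E.law E.truth) ≤ α)
    (hβ : ∀ k, ∀ θ ∈ S ∩ F k, ∫⁻ x, (1 - φ k x) ∂(E.law θ) ≤ β)
    (hγ : ∀ k, E.prior k (F k)ᶜ ≤ γ) :
    ∫⁻ x, E.posterior x S ∂(E.law E.truth) ≤
      Fintype.card E.Index * α + E.law E.truth Aᶜ + (β + γ) / c := by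
  set Φ : E.Obs → ℝ≥0∞ := fun x => ∑ k, φ k x with hΦ
  have hΦm : Measurable Φ := Finset.measurable_fun_sum _ fun k _ => hφ k
  have hψm : ∀ k, Measurable fun x => 1 - φ k x := fun k => measurable_const.sub (hφ k)
  have hpt : ∀ x, E.posterior x S ≤
      Φ x + Aᶜ.indicator 1 x + A.indicator (fun x => (1 - Φ x) * E.posterior x S) x := by
    intro x
    by_cases hx : x ∈ A
    · rw [Set.indicator_of_mem hx, Set.indicator_of_notMem (by simpa using hx), add_zero]
      calc E.posterior x S = 1 * E.posterior x S := (one_mul _).symm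
        _ ≤ (Φ x + (1 - Φ x)) * E.posterior x S := by gcongr; exact le_add_tsub
        _ ≤ Φ x + (1 - Φ x) * E.posterior x S := by
          rw [add_mul]
          gcongr
          exact mul_le_of_le_one_right' (E.posterior_le_one x S)
    · rw [Set.indicator_of_mem (s := Aᶜ) hx]
      exact (E.posterior_le_one x S).trans (le_add_right (le_add_left le_rfl))
  -- In the summand of model `k`, `1 - Φ ≤ 1 - φ k`. Tonelli turns it into a prior average of type
  -- II errors, at most `β` on the sieve and trivially at most `1` off it.
  have hnum : ∫⁻ x, (1 - Φ x) * E.jointMass x S ∂E.base ≤ β + γ := by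
    have hk : ∀ k, ∫⁻ x, (1 - φ k x) * ∫⁻ θ in S, (E.density θ x : ℝ≥0∞) ∂(E.prior k) ∂E.base
        ≤ β + γ := by
      intro k
      rw [E.lintegral_mul_setLIntegral_density (hψm k)]
      have hsub : S ⊆ (S ∩ F k) ∪ (F k)ᶜ := fun θ hθ => by
        by_cases h : θ ∈ F k
        · exact Or.inl ⟨hθ, h⟩
        · exact Or.inr h
      calc ∫⁻ θ in S, ∫⁻ x, (1 - φ k x) ∂(E.law θ) ∂(E.prior k)
          ≤ ∫⁻ θ in (S ∩ F k) ∪ (F k)ᶜ, ∫⁻ x, (1 - φ k x) ∂(E.law θ) ∂(E.prior k) :=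
            lintegral_mono_set hsub
        _ ≤ (∫⁻ θ in S ∩ F k, ∫⁻ x, (1 - φ k x) ∂(E.law θ) ∂(E.prior k)) +
            ∫⁻ θ in (F k)ᶜ, ∫⁻ x, (1 - φ k x) ∂(E.law θ) ∂(E.prior k) := lintegral_union_le _ _ _
        _ ≤ (∫⁻ θ in S ∩ F k, β ∂(E.prior k)) + ∫⁻ θ in (F k)ᶜ, 1 ∂(E.prior k) := by
            gcongr ?_ + ?_
            · exact setLIntegral_mono' (hS.inter (hF k)) (hβ k)
            · refine lintegral_mono fun θ => ?_
              calc ∫⁻ x, (1 - φ k x) ∂(E.law θ) ≤ ∫⁻ _, 1 ∂(E.law θ) :=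
                    lintegral_mono fun _ => tsub_le_self
                _ = 1 := by simp
        _ ≤ β + γ := by
            rw [setLIntegral_const, setLIntegral_const, one_mul]
            gcongr
            · exact mul_le_of_le_one_right' prob_le_one
            · exact hγ k
    calc ∫⁻ x, (1 - Φ x) * E.jointMass x S ∂E.base
        ≤ ∫⁻ x, ∑ k, E.weight k *
            ((1 - φ k x) * ∫⁻ θ in S, (E.density θ x : ℝ≥0∞) ∂(E.prior k)) ∂E.base := by
          refine lintegral_mono fun x => ?_
          simp only [jointMass, Finset.mul_sum]
          refine Finset.sum_le_sum fun k _ => ?_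
          rw [mul_left_comm]
          gcongr
          exact Finset.single_le_sum (f := fun k => φ k x) (fun _ _ => zero_le)
            (Finset.mem_univ k)
      _ = ∑ k, E.weight k *
            ∫⁻ x, (1 - φ k x) * ∫⁻ θ in S, (E.density θ x : ℝ≥0∞) ∂(E.prior k) ∂E.base := by
          rw [lintegral_finsetSum]
          · refine Finset.sum_congr rfl fun k _ => ?_
            exact lintegral_const_mul _ ((hψm k).mul (E.measurable_setLIntegral_density k S))
          · exact fun k _ =>
              ((hψm k).mul (E.measurable_setLIntegral_density k S)).const_mul _
      _ ≤ ∑ k, E.weight k * (β + γ) := Finset.sum_le_sum fun k _ => mul_le_mul_right (hk k) _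
      _ = β + γ := by
          rw [← Finset.sum_mul, ← tsum_fintype (L := .unconditional _), E.weight.tsum_coe, one_mul]
  calc ∫⁻ x, E.posterior x S ∂(E.law E.truth)
      ≤ ∫⁻ x, (Φ x + Aᶜ.indicator 1 x +
          A.indicator (fun x => (1 - Φ x) * E.posterior x S) x) ∂(E.law E.truth) :=
        lintegral_mono hpt
    _ = (∫⁻ x, Φ x ∂(E.law E.truth)) + E.law E.truth Aᶜ +
        ∫⁻ x, A.indicator (fun x => (1 - Φ x) * E.posterior x S) x ∂(E.law E.truth) := by
        rw [lintegral_add_left (f := fun x => Φ x + Aᶜ.indicator 1 x)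
          (hΦm.add (measurable_one.indicator hA.compl)), lintegral_add_left hΦm,
          lintegral_indicator_one hA.compl]
    _ ≤ Fintype.card E.Index * α + E.law E.truth Aᶜ + (β + γ) / c := by
        gcongr ?_ + _ + ?_
        · rw [lintegral_finsetSum _ fun k _ => hφ k]
          calc ∑ k, ∫⁻ x, φ k x ∂(E.law E.truth) ≤ ∑ _k : E.Index, α :=
                Finset.sum_le_sum fun k _ => hα k
            _ = _ := by rw [Finset.sum_const, nsmul_eq_mul, Finset.card_univ]
        · have hm : Measurable fun x => A.indicator (fun x => (1 - Φ x) * E.posterior x S) x :=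
            ((measurable_const.sub hΦm).mul (E.measurable_posterior S)).indicator hA
          -- Over `base`, the true density divided by the evidence is at most `c⁻¹` on `A`, leaving
          -- the numerator alone.
          rw [E.lintegral_law _ hm]
          calc _ ≤ ∫⁻ x, (1 - Φ x) * E.jointMass x S * c⁻¹ ∂E.base := by
                refine lintegral_mono_ae ?_
                filter_upwards [hAc] with x hx
                by_cases hxA : x ∈ A
                · rw [Set.indicator_of_mem hxA, mul_left_comm, mul_assoc]
                  refine mul_le_mul_right ?_ _
                  rw [posterior_eq_jointMass_div, div_eq_mul_inv, mul_left_comm, ← div_eq_mul_inv]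
                  refine mul_le_mul_right ?_ _
                  refine ENNReal.div_le_of_le_mul ?_
                  calc (E.density E.truth x : ℝ≥0∞) = c⁻¹ * (c * E.density E.truth x) := by
                        rw [← mul_assoc, ENNReal.inv_mul_cancel hc hc', one_mul]
                    _ ≤ _ := by gcongr; exact hx hxA
                · simp [Set.indicator_of_notMem hxA]
            _ = (∫⁻ x, (1 - Φ x) * E.jointMass x S ∂E.base) * c⁻¹ :=
                lintegral_mul_const' _ _ (ENNReal.inv_ne_top.2 hc)
            _ ≤ (β + γ) / c := by rw [div_eq_mul_inv]; gcongr

end Decomposition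

end ModelSelection

namespace ModelSelection

/-! ### The oracle rate and the finite sample bound -/

section Rate

lemma ofReal_exp_neg_toReal_negLog_le {p : ℝ≥0∞} (h : negLog p ≠ ∞) :
    ENNReal.ofReal (Real.exp (-(negLog p).toReal)) ≤ p := by
  rw [← ENNReal.log_le_log_iff, ENNReal.log_ofReal_of_pos (Real.exp_pos _), Real.log_exp,
    EReal.coe_neg, EReal.neg_le]
  have h1 : -ENNReal.log p ≤ ((negLog p : ℝ≥0∞) : EReal) := by
    rw [negLog, EReal.coe_toENNReal_eq_max]
    exact le_max_right _ _
  refine h1.trans_eq ?_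
  rw [← EReal.coe_ennreal_toReal h]

variable (E : ModelSelection)

/-- A model and a radius that nearly attain the oracle rate have a large prior mass. -/
lemma exists_prior_mass_ge {n : ℕ} (hn : 1 ≤ n) {r : ℝ} (hr : 0 < r)
    (hE : E.oracleRateSq n = ENNReal.ofReal r) :
    ∃ (k : E.Index) (ε : ℝ), n * ε ^ 2 ≤ 2 * (n * r) ∧ E.prior k (E.klBall n k ε) ≠ 0 ∧
      ENNReal.ofReal (Real.exp (-(2 * (n * r)))) ≤
        ENNReal.ofReal (Real.exp (-(n * ε ^ 2))) * E.prior k (E.klBall n k ε) * E.weight k := by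
  have hn0 : (0 : ℝ) < n := by exact_mod_cast hn
  have hn0' : (n : ℝ≥0∞) ≠ 0 := by exact_mod_cast (by omega : n ≠ 0)
  -- The infimum over radii need not be attained; since `r > 0`, relaxing the bound to `2 * r`
  -- provides a witness.
  have hlt : (⨅ k : E.Index, (⨅ (ε : ℝ) (_ : 0 < ε),
      (ENNReal.ofReal (ε ^ 2) + E.localComplexity n k ε)) + negLog (E.weight k) / n) <
        ENNReal.ofReal (2 * r) := by
    refine (le_self_add.trans_eq hE : _ ≤ _).trans_lt ?_
    exact (ENNReal.ofReal_lt_ofReal_iff (by positivity)).2 (by linarith)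
  obtain ⟨k, hk⟩ := iInf_lt_iff.1 hlt
  rw [ENNReal.iInf_add] at hk
  obtain ⟨ε, hε⟩ := iInf_lt_iff.1 hk
  rw [ENNReal.iInf_add] at hε
  obtain ⟨-, h⟩ := iInf_lt_iff.1 hε
  set P := E.prior k (E.klBall n k ε)
  have hmul : ENNReal.ofReal (n * ε ^ 2) + negLog P + negLog (E.weight k) ≤
      ENNReal.ofReal (2 * (n * r)) := by
    have := mul_le_mul_right h.le (n : ℝ≥0∞)
    rw [localComplexity, mul_add, mul_add, ENNReal.mul_div_cancel hn0' (by simp),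
      ENNReal.mul_div_cancel hn0' (by simp), ← ENNReal.ofReal_natCast,
      ← ENNReal.ofReal_mul hn0.le, ← ENNReal.ofReal_mul hn0.le] at this
    rwa [mul_left_comm]
  have hne := ne_top_of_le_ne_top ENNReal.ofReal_ne_top hmul
  have hw : negLog (E.weight k) ≠ ∞ := (ENNReal.add_ne_top.1 hne).2
  have hP : negLog P ≠ ∞ := (ENNReal.add_ne_top.1 (ENNReal.add_ne_top.1 hne).1).2
  have hsum : n * ε ^ 2 + (negLog P).toReal + (negLog (E.weight k)).toReal ≤ 2 * (n * r) := by
    have := ENNReal.toReal_le_of_le_ofReal (by positivity) hmul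
    rwa [ENNReal.toReal_add (ENNReal.add_ne_top.1 hne).1 hw,
      ENNReal.toReal_add ENNReal.ofReal_ne_top hP, ENNReal.toReal_ofReal (by positivity)] at this
  have hP' := ofReal_exp_neg_toReal_negLog_le hP
  refine ⟨k, ε, ?_, ?_, ?_⟩
  · linarith [ENNReal.toReal_nonneg (a := negLog P),
      ENNReal.toReal_nonneg (a := negLog (E.weight k))]
  · intro h0
    have hle := ENNReal.ofReal_eq_zero.1 (nonpos_iff_eq_zero.1 (hP'.trans_eq h0))
    exact absurd (Real.exp_pos _) hle.not_gt
  · calc ENNReal.ofReal (Real.exp (-(2 * (n * r))))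
        ≤ ENNReal.ofReal (Real.exp (-(n * ε ^ 2)) * Real.exp (-(negLog P).toReal) *
            Real.exp (-(negLog (E.weight k)).toReal)) := by
          rw [← Real.exp_add, ← Real.exp_add]
          refine ENNReal.ofReal_le_ofReal (Real.exp_le_exp.2 ?_)
          linarith
      _ = ENNReal.ofReal (Real.exp (-(n * ε ^ 2))) *
            ENNReal.ofReal (Real.exp (-(negLog P).toReal)) *
            ENNReal.ofReal (Real.exp (-(negLog (E.weight k)).toReal)) := by
          rw [ENNReal.ofReal_mul (by positivity), ENNReal.ofReal_mul (by positivity)]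
      _ ≤ _ := by
          gcongr
          exact ofReal_exp_neg_toReal_negLog_le hw

/-- The marginal likelihood is bounded from below, with large probability, in terms of the
oracle rate. -/
lemma exists_jointMass_univ_ge {n : ℕ} (hn : 1 ≤ n) {r : ℝ} (hr : 0 < r)
    (hE : E.oracleRateSq n = ENNReal.ofReal r) :
    ∃ A : Set E.Obs, MeasurableSet A ∧
      E.law E.truth Aᶜ ≤ ENNReal.ofReal (2 / (n * r)) ∧
      ∀ᵐ x ∂E.base, x ∈ A →
        ENNReal.ofReal (Real.exp (-(3 * (n * r)))) * E.density E.truth x ≤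
          E.jointMass x Set.univ := by
  have hn0 : (0 : ℝ) < n := by exact_mod_cast hn
  obtain ⟨k, ε, hε, hP, hmass⟩ := E.exists_prior_mass_ge hn hr hE
  have hu : 0 < n * r := by positivity
  -- The choice `t = n * r` adds one more `n * r` to the exponent `2 * (n * r)`.
  obtain ⟨A, hA, hAc, hAx⟩ := E.exists_marginal_likelihood_ge n k hu hP
  refine ⟨A, hA, hAc.trans (ENNReal.ofReal_le_ofReal ?_), ?_⟩
  · rw [div_le_div_iff₀ (by positivity) hu]
    nlinarith [mul_le_mul_of_nonneg_right hε hu.le]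
  · filter_upwards [hAx] with x hx hxA
    calc ENNReal.ofReal (Real.exp (-(3 * (n * r)))) * E.density E.truth x
        = ENNReal.ofReal (Real.exp (-(n * r))) * ENNReal.ofReal (Real.exp (-(2 * (n * r)))) *
            E.density E.truth x := by
          rw [← ENNReal.ofReal_mul (Real.exp_pos _).le, ← Real.exp_add]
          ring_nf
      _ ≤ ENNReal.ofReal (Real.exp (-(n * r))) * (ENNReal.ofReal (Real.exp (-(n * ε ^ 2))) *
            E.prior k (E.klBall n k ε) * E.weight k) * E.density E.truth x := by gcongr
      _ = E.weight k * (ENNReal.ofReal (Real.exp (-(n * ε ^ 2 + n * r))) * E.density E.truth x *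
            E.prior k (E.klBall n k ε)) := by
          rw [neg_add, Real.exp_add, ENNReal.ofReal_mul (Real.exp_pos _).le]
          ring
      _ ≤ E.weight k * ∫⁻ θ, E.density θ x ∂(E.prior k) := by gcongr; exact hx hxA
      _ ≤ E.jointMass x Set.univ := by
          simp only [jointMass, Measure.restrict_univ]
          exact Finset.single_le_sum
            (f := fun k => E.weight k * ∫⁻ θ, (E.density θ x : ℝ≥0∞) ∂(E.prior k))
            (fun _ _ => zero_le) (Finset.mem_univ k)

lemma card_index_le_of_oracleRateSq {n : ℕ} (hn : 1 ≤ n) {r : ℝ} (hr : 0 < r)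
    (hE : E.oracleRateSq n = ENNReal.ofReal r) :
    (Fintype.card E.Index : ℝ≥0∞) ≤ ENNReal.ofReal (Real.exp (n * r)) := by
  have hn0 : (0 : ℝ) < n := by exact_mod_cast hn
  have hn0' : (n : ℝ≥0∞) ≠ 0 := by exact_mod_cast (by omega : n ≠ 0)
  have h : ENNReal.ofReal (Real.log (Fintype.card E.Index)) / n ≤ ENNReal.ofReal r :=
    hE ▸ le_add_self
  rw [ENNReal.div_le_iff hn0' (by simp), ← ENNReal.ofReal_natCast, ← ENNReal.ofReal_mul hr.le,
    ENNReal.ofReal_le_ofReal_iff (by positivity), mul_comm] at h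
  rw [← ENNReal.ofReal_natCast]
  refine ENNReal.ofReal_le_ofReal ?_
  rcases Nat.eq_zero_or_pos (Fintype.card E.Index) with h0 | h0
  · rw [h0, Nat.cast_zero]
    positivity
  · exact (Real.log_le_iff_le_exp (by exact_mod_cast h0)).1 h

lemma measurableSet_far (c : ℝ≥0∞) :
    MeasurableSet {θ | c < ENNReal.ofReal (dist θ E.truth ^ 2)} :=
  measurableSet_lt measurable_const (E.measurable_dist_truth.pow_const 2).ennreal_ofReal

/-- Finite sample bound of the expected posterior mass outside a ball whose radius is a large
multiple `R` of the oracle rate. -/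
lemma lintegral_posterior_far_le {n : ℕ} (hn : 1 ≤ n) {a b D : ℝ} (hD : 1 < D)
    {K J : ℝ≥0} (hKJ : K ≤ J) (hJ : 2 ≤ J) {R : ℝ} (hR : 0 < R) (haR : 2 * J ≤ a * R)
    (hbR : J ^ 2 + 4 ≤ b * R ^ 2)
    (hT : ∀ k : E.Index, E.TestCondition n k a b)
    (hS : ∀ k : E.Index, ∀ ε : ℝ≥0, 0 < ε →
      (K : ℝ≥0∞) ^ 2 * E.oracleRateSq n ≤ (ε : ℝ≥0∞) ^ 2 → E.SieveConditionAt n k D ε)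
    (h0 : E.oracleRateSq n ≠ 0) {M : ℝ≥0} (hM : R ^ 2 ≤ M) :
    ∫⁻ x, E.posterior x {θ | (M : ℝ≥0∞) * E.oracleRateSq n < ENNReal.ofReal (dist θ E.truth ^ 2)}
      ∂(E.law E.truth) ≤ 5 / (n * E.oracleRateSq n) := by
  have hn0 : (0 : ℝ) < n := by exact_mod_cast hn
  have hMpos : (0 : ℝ) < M := lt_of_lt_of_le (by positivity) hM
  rcases eq_or_ne (E.oracleRateSq n) ∞ with htop | htop
  -- An infinite rate makes the far set empty.
  · have hM0 : (M : ℝ≥0∞) ≠ 0 := by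
      rw [Ne, ENNReal.coe_eq_zero, ← NNReal.coe_eq_zero]
      exact hMpos.ne'
    simp [htop, ENNReal.mul_top hM0, posterior]
  obtain ⟨r, hr, hE⟩ : ∃ r : ℝ, 0 < r ∧ E.oracleRateSq n = ENNReal.ofReal r :=
    ⟨_, ENNReal.toReal_pos h0 htop, (ENNReal.ofReal_toReal htop).symm⟩
  obtain ⟨A, hA, hAc, hAx⟩ := E.exists_jointMass_univ_ge hn hr hE
  have hcard := E.card_index_le_of_oracleRateSq hn hr hE
  set u : ℝ := n * r with hu
  have hupos : 0 < u := by positivity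
  set ε : ℝ≥0 := J * NNReal.sqrt r.toNNReal with hε
  have hJ' : (2 : ℝ) ≤ J := by exact_mod_cast hJ
  have hεcoe : (ε : ℝ) = J * √r := by
    rw [hε, NNReal.coe_mul, Real.coe_sqrt, Real.coe_toNNReal _ hr.le]
  have hεsq : n * (ε : ℝ) ^ 2 = J ^ 2 * u := by
    rw [hεcoe, mul_pow, Real.sq_sqrt hr.le, hu]; ring
  have hρsq : b * n * (R * √r) ^ 2 = b * R ^ 2 * u := by
    rw [mul_pow, Real.sq_sqrt hr.le, hu]; ring
  have hεpos : 0 < ε := by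
    rw [← NNReal.coe_pos, hεcoe]; positivity
  have hεK : (K : ℝ≥0∞) ^ 2 * E.oracleRateSq n ≤ (ε : ℝ≥0∞) ^ 2 := by
    rw [hE, hε, ENNReal.coe_mul, mul_pow, ← ENNReal.coe_pow (NNReal.sqrt _), NNReal.sq_sqrt,
      ENNReal.ofReal]
    gcongr
  have hερ : 2 * (ε : ℝ) ≤ a * (R * √r) := by
    rw [hεcoe, ← mul_assoc, ← mul_assoc]
    gcongr
  choose φ hφ hφ0 F hF hFc hφ1 using fun k =>
    E.exists_test_sieve (hT k) (hS k ε hεpos hεK) (ρ := R * √r) (by positivity) hερ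
  set S := {θ | (M : ℝ≥0∞) * E.oracleRateSq n < ENNReal.ofReal (dist θ E.truth ^ 2)} with hSdef
  have hSfar : ∀ θ ∈ S, R * √r < dist θ E.truth := by
    intro θ hθ
    have hθ' : (M : ℝ≥0∞) * E.oracleRateSq n < ENNReal.ofReal (dist θ E.truth ^ 2) := hθ
    rw [hE, ← ENNReal.ofReal_coe_nnreal, ← ENNReal.ofReal_mul hMpos.le] at hθ'
    have h1 := (ENNReal.ofReal_lt_ofReal_iff_of_nonneg (by positivity)).1 hθ'
    refine lt_of_pow_lt_pow_left₀ 2 dist_nonneg ?_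
    rw [mul_pow, Real.sq_sqrt hr.le]
    exact lt_of_le_of_lt (by gcongr) h1
  have hexp : Real.exp (-u) ≤ 1 / u := by
    rw [Real.exp_neg, ← one_div]
    exact one_div_le_one_div_of_le hupos (by linarith [Real.add_one_le_exp u])
  have hdiv : ∀ s : ℝ, 4 * u ≤ s → ENNReal.ofReal (Real.exp (-s)) /
      ENNReal.ofReal (Real.exp (-(3 * u))) ≤ ENNReal.ofReal (1 / u) := fun s hs => by
    rw [← ENNReal.ofReal_div_of_pos (Real.exp_pos _), ← Real.exp_sub]
    refine ENNReal.ofReal_le_ofReal (le_trans (Real.exp_le_exp.2 ?_) hexp)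
    linarith
  have hbu : (J ^ 2 + 4) * u ≤ b * R ^ 2 * u := by gcongr
  have hJu : 0 ≤ (J : ℝ) ^ 2 * u := by positivity
  -- Exponent `4u` leaves `exp (-u)` after division by the evidence bound; `J ≥ 2` supplies the `4`.
  have hDu : 4 * u ≤ D * (J ^ 2 * u) := by
    have h4 : 4 * u ≤ (J : ℝ) ^ 2 * u := by
      gcongr
      nlinarith
    nlinarith [mul_le_mul_of_nonneg_right hD.le hJu]
  calc ∫⁻ x, E.posterior x S ∂(E.law E.truth)
      ≤ Fintype.card E.Index *
            ENNReal.ofReal (Real.exp (n * (ε : ℝ) ^ 2 - b * n * (R * √r) ^ 2)) +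
          E.law E.truth Aᶜ +
          (ENNReal.ofReal (Real.exp (-(b * n * (R * √r) ^ 2))) +
            ENNReal.ofReal (Real.exp (-(D * n * (ε : ℝ) ^ 2)))) /
          ENNReal.ofReal (Real.exp (-(3 * u))) :=
        E.lintegral_posterior_le hφ (E.measurableSet_far _) hF hA
          (ENNReal.ofReal_pos.2 (Real.exp_pos _)).ne' ENNReal.ofReal_ne_top hAx hφ0
          (fun k θ hθ => hφ1 k θ hθ.2 (hSfar θ hθ.1)) hFc
    _ ≤ ENNReal.ofReal (1 / u) + ENNReal.ofReal (2 / u) +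
          (ENNReal.ofReal (1 / u) + ENNReal.ofReal (1 / u)) := by
        rw [ENNReal.add_div, hεsq, hρsq, mul_assoc D, hεsq]
        gcongr ?_ + ?_ + (?_ + ?_)
        · calc _ ≤ ENNReal.ofReal (Real.exp u) *
                ENNReal.ofReal (Real.exp (J ^ 2 * u - b * R ^ 2 * u)) := by gcongr
            _ ≤ _ := by
                rw [← ENNReal.ofReal_mul (Real.exp_pos _).le, ← Real.exp_add]
                refine ENNReal.ofReal_le_ofReal (le_trans (Real.exp_le_exp.2 ?_) hexp)
                linarith
        · exact hdiv _ (by linarith)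
        · exact hdiv _ hDu
    _ = ENNReal.ofReal (5 / u) := by
        rw [← ENNReal.ofReal_add (by positivity) (by positivity),
          ← ENNReal.ofReal_add (by positivity) (by positivity),
          ← ENNReal.ofReal_add (by positivity) (by positivity)]
        congr 1
        ring
    _ = 5 / (n * E.oracleRateSq n) := by
        rw [ENNReal.ofReal_div_of_pos hupos, hE, hu, ENNReal.ofReal_mul hn0.le,
          ENNReal.ofReal_natCast, ENNReal.ofReal_ofNat]

end Rate

end ModelSelection

/-- With `K = 0` the hypothesis `hA3` is the sieve condition at every radius `ε > 0`; for `K > 0`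
it is only required at the radii `ε` that are at least `K` times the oracle rate. -/
theorem mainTheorem4
    (E : ℕ → ModelSelection)
    (a b : ℝ) (ha : 0 < a) (hb : 0 < b)
    (hA1 : ∀ n, 1 ≤ n → ∀ k : (E n).Index, (E n).TestCondition n k a b)
    (D : ℝ) (hD : 1 < D) (K : ℝ≥0)
    (hA3 : ∀ n, 1 ≤ n → ∀ k : (E n).Index, ∀ ε : ℝ≥0, 0 < ε →
      (K : ℝ≥0∞) ^ 2 * (E n).oracleRateSq n ≤ (ε : ℝ≥0∞) ^ 2 →
        (E n).SieveConditionAt n k D ε)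
    (hrate : Tendsto (fun n : ℕ => (n : ℝ≥0∞) * (E n).oracleRateSq n) atTop (𝓝 ∞)) :
    ∃ M₀ : ℝ≥0, 0 < M₀ ∧ ∀ M : ℝ≥0, M₀ ≤ M →
      Tendsto
        (fun n : ℕ => ∫⁻ x, (E n).posterior x
            {θ | (M : ℝ≥0∞) * (E n).oracleRateSq n < ENNReal.ofReal (dist θ (E n).truth ^ 2)}
          ∂((E n).law (E n).truth))
        atTop (𝓝 0) := by
  set J : ℝ≥0 := max K 2 with hJ
  -- The summands secure `2J ≤ aR`, `J² + 4 ≤ bR`, and `R ≥ 1`, the last giving `R ≤ R²`.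
  set R : ℝ := 2 * J / a + (J ^ 2 + 4) / b + 1 with hR
  have h1 : 0 ≤ 2 * J / a := by positivity
  have h2 : 0 ≤ ((J : ℝ) ^ 2 + 4) / b := by positivity
  have hR1 : 1 ≤ R := by linarith
  have haR : 2 * J ≤ a * R := by
    calc 2 * (J : ℝ) = a * (2 * J / a) := by field_simp
      _ ≤ a * R := by gcongr; linarith
  have hbR : (J : ℝ) ^ 2 + 4 ≤ b * R ^ 2 := by
    calc (J : ℝ) ^ 2 + 4 = b * ((J ^ 2 + 4) / b) := by field_simp
      _ ≤ b * R := by gcongr; linarith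
      _ ≤ b * R ^ 2 := by gcongr; exact le_self_pow₀ hR1 two_ne_zero
  refine ⟨(R ^ 2).toNNReal, Real.toNNReal_pos.2 (by positivity), fun M hM => ?_⟩
  have hM' : R ^ 2 ≤ M := Real.toNNReal_le_iff_le_coe.1 hM
  have hlim : Tendsto (fun n : ℕ => 5 / ((n : ℝ≥0∞) * (E n).oracleRateSq n)) atTop (𝓝 0) := by
    have := ENNReal.Tendsto.const_div (a := 5) hrate (Or.inr (by simp))
    simpa using this
  refine tendsto_of_tendsto_of_tendsto_of_le_of_le' tendsto_const_nhds hlim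
    (Eventually.of_forall fun _ => zero_le) ?_
  filter_upwards [eventually_ge_atTop 1,
    hrate.eventually_ne ENNReal.top_ne_zero] with n hn hne
  exact (E n).lintegral_posterior_far_le hn hD (le_max_left K 2) (le_max_right K 2)
    (by positivity) haR hbR (hA1 n hn) (hA3 n hn) (right_ne_zero_of_mul hne) hM'
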